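/- Let $d=d_1+d_2$ with integers $d_1,d_2\ge 0$, let $A$ be an invertible real $d\times d$ matrix, let $\mathcal T=A(\mathbb Z^{d_1}\times\{0\})$ (a discrete subgroup of $\mathbb R^d$), and let $\Omega\subseteq\mathbb R^d$ be Lebesgue measurable. Definitions. The set $\Omega$ *tiles $\mathbb R^d$ by $\mathcal T$* if $\{\Omega+t : t\in\mathcal T\}$ is a partition of $\mathbb R^d$ up to Lebesgue measure zero (the translates cover almost every point, and translates by distinct $t,t'\in\mathcal T$ intersect in a null set). For $f\in L^1(\Omega)$, extended by $0$ outside $\Omega$, put $\hat f(\lambda)=\int_{\Omega}f(t)e^{-2\pi i\lambda\cdot t}\,dt$. A positive Radon measure $\mu$ on $\mathbb R^d$ is a *pair measure* for $\Omega$ if $\int|\hat f|^2\,d\mu<\infty$ for every $f\in L^1(\Omega)\cap L^2(\Omega)$, and the map $f\mapsto\hat f$ from $L^1(\Omega)\cap L^2(\Omega)\subseteq L^2(\Omega)$ into $L^2(\mu)$ is isometric and has dense range. Let $\delta_{\mathbb Z^{d_1}}$ be the counting measure on the subset $\mathbb Z^{d_1}$ of $\mathbb R^{d_1}$, let $\mathfrak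 m_{d_2}$ be Lebesgue measure on $\mathbb R^{d_2}$, and for a Borel measure $\mu$ on $\mathbb R^d$ define the measure $A^T\mu$ by $A^T\mu(E)=|\det (A^T)^{-1}|\,\mu(A^TE)$ for Borel sets $E$. The *dual set* of $\mathcal T$ is $\mathcal T^*=\{\gamma^*\in\mathbb R^d : \gamma^*\cdot\gamma\in\mathbb Z\text{ for all }\gamma\in\mathcal T\}$. Theorem. The set $\Omega$ tiles $\mathbb R^d$ by $\mathcal T$ if and only if $A^T(\delta_{\mathbb Z^{d_1}}\times\mathfrak m_{d_2})$ is a pair measure for $\Omega$. Moreover, this measure is supported on $\mathcal T^*$, that is, the complement of $\mathcal T^*$ has measure zero for it. -/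

import Mathlib

open MeasureTheory
open scoped FourierTransform Matrix

/-- The family `{Ω + t : t ∈ T}` is a partition of `ℝ^d` up to Lebesgue measure zero: the translates
cover almost all of `ℝ^d`, and two translates by different elements of `T` meet in a null set. -/
def Tiles {d : ℕ} (Ω T : Set (EuclideanSpace ℝ (Fin d))) : Prop :=
  volume (⋃ t ∈ T, (fun x => x + t) '' Ω)ᶜ = 0 ∧
    ∀ t ∈ T, ∀ t' ∈ T, t ≠ t' →
      volume (((fun x => x + t) '' Ω) ∩ ((fun x => x + t') '' Ω)) = 0

/-- `f`, restricted to `Ω`, represents an element of `L¹(Ω) ∩ L²(Ω)`. -/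
def InL1L2 {d : ℕ} (Ω : Set (EuclideanSpace ℝ (Fin d))) (f : EuclideanSpace ℝ (Fin d) → ℂ) : Prop :=
  MemLp f 1 (volume.restrict Ω) ∧ MemLp f 2 (volume.restrict Ω)

/-- The classical Fourier transform `λ ↦ ∫_Ω f(t) exp(-2πi λ·t) dt` of a function on `Ω`,
extended by zero outside `Ω`. -/
noncomputable def fourierOn {d : ℕ} (Ω : Set (EuclideanSpace ℝ (Fin d)))
    (f : EuclideanSpace ℝ (Fin d) → ℂ) : EuclideanSpace ℝ (Fin d) → ℂ :=
  𝓕 (Ω.indicator f)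

/-- `(Ω, μ)` is a spectral pair, i.e. `μ` is a pair measure for `Ω`: `μ` is a Radon measure, and
`f ↦ f̂` maps `L¹(Ω) ∩ L²(Ω)` into `L²(μ)`, isometrically for the `L²` norms and with dense range. -/
structure IsPairMeasure {d : ℕ} (Ω : Set (EuclideanSpace ℝ (Fin d)))
    (μ : Measure (EuclideanSpace ℝ (Fin d))) : Prop where
  radon : μ.Regular
  memLp : ∀ f, InL1L2 Ω f → MemLp (fourierOn Ω f) 2 μ
  isometric : ∀ f, InL1L2 Ω f → eLpNorm (fourierOn Ω f) 2 μ = eLpNorm f 2 (volume.restrict Ω)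
  dense_range : Dense {g : Lp ℂ 2 μ | ∃ f, InL1L2 Ω f ∧ g =ᵐ[μ] fourierOn Ω f}

/-- The subgroup `ℤ^{d₁} × {0}` of `ℝ^{d₁ + d₂}`. -/
def intSubgroup (d₁ d₂ : ℕ) : AddSubgroup (EuclideanSpace ℝ (Fin (d₁ + d₂))) where
  carrier := {x | (∀ i : Fin d₁, ∃ n : ℤ, x (Fin.castAdd d₂ i) = (n : ℝ)) ∧
    ∀ j : Fin d₂, x (Fin.natAdd d₁ j) = 0}
  zero_mem' := ⟨fun _ => ⟨0, by simp⟩, fun _ => by simp⟩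
  add_mem' := by
    rintro x y ⟨hx, hx'⟩ ⟨hy, hy'⟩
    refine ⟨fun i => ?_, fun j => ?_⟩
    · obtain ⟨m, hm⟩ := hx i
      obtain ⟨n, hn⟩ := hy i
      exact ⟨m + n, by simp [hm, hn]⟩
    · simp [hx' j, hy' j]
  neg_mem' := by
    rintro x ⟨hx, hx'⟩
    refine ⟨fun i => ?_, fun j => ?_⟩
    · obtain ⟨m, hm⟩ := hx i
      exact ⟨-m, by simp [hm]⟩
    · simp [hx' j]

/-- The subgroup `A(ℤ^{d₁} × {0})` of `ℝ^{d₁ + d₂}`. -/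
noncomputable def matSubgroup {d₁ d₂ : ℕ} (A : Matrix (Fin (d₁ + d₂)) (Fin (d₁ + d₂)) ℝ) :
    AddSubgroup (EuclideanSpace ℝ (Fin (d₁ + d₂))) :=
  (intSubgroup d₁ d₂).map (Matrix.toEuclideanLin A).toAddMonoidHom

/-- The dual set of a subgroup `T` of `ℝ^d`: the vectors whose dot product with every element of
`T` is an integer. -/
def dualSet {d : ℕ} (T : AddSubgroup (EuclideanSpace ℝ (Fin d))) :
    Set (EuclideanSpace ℝ (Fin d)) :=
  {x | ∀ t ∈ T, ∃ n : ℤ, inner ℝ x t = (n : ℝ)}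

/-- The identification `(x₁, x₂) ↦ x` of `ℝ^{d₁} × ℝ^{d₂}` with `ℝ^{d₁ + d₂}`. -/
noncomputable def joinCoords {d₁ d₂ : ℕ}
    (p : EuclideanSpace ℝ (Fin d₁) × EuclideanSpace ℝ (Fin d₂)) :
    EuclideanSpace ℝ (Fin (d₁ + d₂)) :=
  WithLp.toLp 2 (Fin.append p.1.ofLp p.2.ofLp)

/-- The counting measure on the subset `ℤ^n` of `ℝ^n`: the sum of the unit point masses at the
integer points. -/
noncomputable def countInt (n : ℕ) : Measure (EuclideanSpace ℝ (Fin n)) :=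
  Measure.sum fun k : Fin n → ℤ => Measure.dirac (WithLp.toLp 2 fun i => (k i : ℝ))

/-- The product, on `ℝ^{d₁ + d₂}`, of the counting measure on `ℤ^{d₁}` and the Lebesgue measure
on `ℝ^{d₂}`. -/
noncomputable def countIntProdLebesgue (d₁ d₂ : ℕ) : Measure (EuclideanSpace ℝ (Fin (d₁ + d₂))) :=
  ((countInt d₁).prod (volume : Measure (EuclideanSpace ℝ (Fin d₂)))).map joinCoords

/-- For an invertible matrix `B`, the measure `Bμ` given by `(Bμ)(E) = |det B⁻¹| μ(B E)`, that is
`|det B⁻¹|` times the image of `μ` under `B⁻¹`. -/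
noncomputable def matMeasure {d : ℕ} (B : Matrix (Fin d) (Fin d) ℝ)
    (μ : Measure (EuclideanSpace ℝ (Fin d))) : Measure (EuclideanSpace ℝ (Fin d)) :=
  ENNReal.ofReal |B⁻¹.det| • μ.map (Matrix.toEuclideanLin B⁻¹)

open Set Filter Topology Real
open scoped ENNReal NNReal Pointwise RealInnerProductSpace

/-! ### Fundamental domains, periodization and pair measures carried by the dual set -/

section FundamentalDomain

variable {d : ℕ} {T : AddSubgroup (EuclideanSpace ℝ (Fin d))}
  {Ω S S' : Set (EuclideanSpace ℝ (Fin d))} {μ : Measure (EuclideanSpace ℝ (Fin d))}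
  {f g : EuclideanSpace ℝ (Fin d) → ℂ}

/-! Write `T` for the lattice and `μ` for the measure in question. Tiling by `T` means being a
fundamental domain of `T`, and `μ` is carried by the dual set, whose characters are `T`-periodic. On
the dual set the transform of `f` therefore depends only on the `T`-periodization of `f`.
Periodizing carries functions on one fundamental domain to functions on another with the same norm
and the same transform there (`exists_periodization`), so if `μ` is a pair measure for one
fundamental domain, it is one for all.

It is one for the model cell, the image under `A` of unit cube times `ℝ^{d₂}`: Parseval for Fourier
series in the cube variables and Plancherel in the others give the isometry, while products of a
character and a Schwartz function give density (`isPairMeasure_latticeCell`). Hence tiling implies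
the pair property.

Conversely, let `μ` be a pair measure for `Ω`. If `Ω` met `t + Ω` in positive measure for some `t ≠
0`, a small piece `U` of the overlap and `U - t` would be disjoint subsets of `Ω` whose indicators
have equal transforms on the dual set, against isometry (`IsPairMeasure.aedisjoint_vadd`). So
adjoining to `Ω` the part of the model cell missed by its translates produces a fundamental domain,
for which `μ` is again a pair measure. Functions on the missed part are orthogonal to functions on
`Ω`, hence so are their transforms; density of the range for `Ω` makes the missed part null
(`IsPairMeasure.volume_missedPart`). -/

theorem image_add_right_eq_vadd (t : T) :
    (fun x => x + (t : EuclideanSpace ℝ (Fin d))) '' Ω = t +ᵥ Ω := by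
  ext x
  simp only [mem_image, Set.mem_vadd_set, AddSubgroup.vadd_def, vadd_eq_add, add_comm]

theorem tiles_iff_isAddFundamentalDomain (hΩ : NullMeasurableSet Ω volume) :
    Tiles Ω T ↔ IsAddFundamentalDomain T Ω volume := by
  have hcov : volume (⋃ t ∈ T, (fun x => x + t) '' Ω)ᶜ = 0 ↔
      ∀ᵐ x, ∃ t : T, t +ᵥ x ∈ Ω := by
    rw [ae_iff]
    have : (⋃ t ∈ T, (fun x => x + t) '' Ω)ᶜ = {x | ¬ ∃ t : T, t +ᵥ x ∈ Ω} := by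
      ext x
      simp only [mem_compl_iff, mem_iUnion, mem_ofPred_eq, not_iff_not]
      constructor
      · rintro ⟨t, ht, hx⟩
        have hx' : x ∈ (⟨t, ht⟩ : T) +ᵥ Ω := by rwa [← image_add_right_eq_vadd]
        exact ⟨-⟨t, ht⟩, Set.mem_vadd_set_iff_neg_vadd_mem.1 hx'⟩
      · rintro ⟨t, ht⟩
        refine ⟨_, (-t).2, ?_⟩
        rw [image_add_right_eq_vadd, Set.mem_vadd_set_iff_neg_vadd_mem, neg_neg]
        exact ht
    rw [this]
  have hdisj : (∀ t ∈ T, ∀ t' ∈ T, t ≠ t' →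
      volume (((fun x => x + t) '' Ω) ∩ ((fun x => x + t') '' Ω)) = 0) ↔
      Pairwise (Function.onFun (AEDisjoint volume) fun t : T => t +ᵥ Ω) := by
    constructor
    · intro h t t' htt'
      have := h t t.2 t' t'.2 (fun e => htt' (Subtype.ext e))
      rwa [image_add_right_eq_vadd, image_add_right_eq_vadd] at this
    · intro h t ht t' ht' htt'
      have : volume (((⟨t, ht⟩ : T) +ᵥ Ω) ∩ ((⟨t', ht'⟩ : T) +ᵥ Ω)) = 0 :=
        h (fun e => htt' (congrArg Subtype.val e))
      rwa [← image_add_right_eq_vadd, ← image_add_right_eq_vadd] at this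
  simp only [Tiles, SetLike.mem_coe]
  rw [hcov, hdisj]
  exact ⟨fun h => ⟨hΩ, h.1, h.2⟩, fun h => ⟨h.ae_covers, h.aedisjoint⟩⟩

theorem memLp_indicator_iff_restrict₀ {p : ℝ≥0∞} (hΩ : NullMeasurableSet Ω volume) :
    MemLp (Ω.indicator f) p ↔ MemLp f p (volume.restrict Ω) := by
  obtain ⟨t, -, ht, hΩt⟩ := hΩ.exists_measurable_superset_ae_eq
  rw [← Measure.restrict_congr_set hΩt, ← memLp_indicator_iff_restrict ht]
  exact memLp_congr_ae (indicator_ae_eq_of_ae_eq_set hΩt.symm)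

theorem InL1L2.congr (hf : InL1L2 Ω f) (h : f =ᵐ[volume.restrict Ω] g) : InL1L2 Ω g :=
  ⟨hf.1.ae_eq h, hf.2.ae_eq h⟩

theorem InL1L2.integrable_indicator (hΩ : NullMeasurableSet Ω volume) (hf : InL1L2 Ω f) :
    Integrable (Ω.indicator f) :=
  memLp_one_iff_integrable.1 ((memLp_indicator_iff_restrict₀ hΩ).2 hf.1)

theorem fourierOn_congr (hΩ : NullMeasurableSet Ω volume) (h : f =ᵐ[volume.restrict Ω] g) :
    fourierOn Ω f = fourierOn Ω g := by
  have : Ω.indicator f =ᵐ[volume] Ω.indicator g := by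
    rw [EventuallyEq, ae_restrict_iff'₀ hΩ] at h
    filter_upwards [h] with x hx
    by_cases hxΩ : x ∈ Ω <;> simp [hxΩ, hx]
  ext w
  simp only [fourierOn, Real.fourier_eq]
  apply integral_congr_ae
  filter_upwards [this] with x hx
  rw [hx]

theorem fourierOn_eq_setIntegral (hΩ : NullMeasurableSet Ω volume)
    (w : EuclideanSpace ℝ (Fin d)) :
    fourierOn Ω f w = ∫ v in Ω, 𝐞 (-⟪v, w⟫) • f v := by
  rw [fourierOn, Real.fourier_eq, ← integral_indicator₀ hΩ]
  congr 1
  ext v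
  by_cases hv : v ∈ Ω <;> simp [hv]

theorem fourierChar_int (n : ℤ) : 𝐞 (n : ℝ) = 1 := by
  ext
  rw [Real.fourierChar_apply]
  simpa [mul_comm, mul_left_comm, mul_assoc] using Complex.exp_int_mul_two_pi_mul_I n

theorem fourierChar_neg_inner_vadd {w : EuclideanSpace ℝ (Fin d)} (hw : w ∈ dualSet T) (t : T)
    (x : EuclideanSpace ℝ (Fin d)) : 𝐞 (-⟪t +ᵥ x, w⟫) = 𝐞 (-⟪x, w⟫) := by
  obtain ⟨n, hn⟩ := hw t t.2
  have : -⟪t +ᵥ x, w⟫ = ((-n : ℤ) : ℝ) + -⟪x, w⟫ := by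
    rw [AddSubgroup.vadd_def, vadd_eq_add, inner_add_left, real_inner_comm, hn]
    push_cast
    ring
  rw [this, AddChar.map_add_eq_mul, fourierChar_int, one_mul]

theorem continuous_fourier_of_integrable (hf : Integrable f) : Continuous (𝓕 f) :=
  VectorFourier.fourierIntegral_continuous Real.continuous_fourierChar
    (by simpa using continuous_inner) hf

theorem eLpNorm_two_eq_lintegral {α : Type*} [MeasurableSpace α] {ν : Measure α} {f : α → ℂ} :
    eLpNorm f 2 ν = (∫⁻ x, ‖f x‖ₑ ^ (2 : ℝ) ∂ν) ^ (1 / 2 : ℝ) := by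
  rw [eLpNorm_eq_lintegral_rpow_enorm_toReal (by simp) (by simp)]
  simp

/-- Functions on two fundamental domains of `T` correspond, by periodization, with the same norms
and the same Fourier transforms on the dual set. -/
theorem exists_periodization [Countable T] (hS : IsAddFundamentalDomain T S volume)
    (hS' : IsAddFundamentalDomain T S' volume) (hf : InL1L2 S' f) :
    ∃ P, InL1L2 S P ∧ eLpNorm P 2 (volume.restrict S) = eLpNorm f 2 (volume.restrict S') ∧
      ∀ w ∈ dualSet T, fourierOn S P w = fourierOn S' f w := by
  set P : EuclideanSpace ℝ (Fin d) → ℂ := fun x => ∑' t : T, S'.indicator f (t +ᵥ x) with hP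
  have hinv : ∀ (t : T) x, P (t +ᵥ x) = P x := by
    intro t x
    simp only [hP, ← add_vadd]
    -- Reindexing needs no summability: where the series diverges, both sides take the same default
    -- value.
    exact (Equiv.addRight t).tsum_eq fun s : T => S'.indicator f (s +ᵥ x)
  -- For almost every point of `S'` no other translate of it lies in `S'`, so only the term `t = 0`
  -- survives.
  have hPf : f =ᵐ[volume.restrict S'] P := by
    rw [EventuallyEq, ae_restrict_iff'₀ hS'.nullMeasurableSet]
    have h1 : ∀ t : T, t ≠ 0 → ∀ᵐ x, ¬ (x ∈ S' ∧ t +ᵥ x ∈ S') := by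
      intro t ht
      have := hS'.aedisjoint (show (-t) ≠ 0 by simpa using ht)
      rw [Function.onFun, AEDisjoint] at this
      rw [ae_iff]
      convert! this using 2
      ext x
      simp [Set.mem_vadd_set_iff_neg_vadd_mem, and_comm]
    have h2 : ∀ᵐ x, ∀ t : T, t ≠ 0 → ¬ (x ∈ S' ∧ t +ᵥ x ∈ S') := by
      rw [ae_all_iff]
      intro t
      by_cases ht : t = 0
      · simp [ht]
      · filter_upwards [h1 t ht] with x hx _ using hx
    filter_upwards [h2] with x hx hxS
    rw [hP]
    dsimp only
    rw [tsum_eq_single 0]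
    · simp [hxS]
    · intro t ht
      exact indicator_of_notMem (fun h => hx t ht ⟨hxS, h⟩) _
  have hnorm : ∀ p : ℝ≥0∞, p ≠ 0 → p ≠ ∞ →
      eLpNorm P p (volume.restrict S) = eLpNorm P p (volume.restrict S') := by
    intro p h0 hp
    rw [eLpNorm_eq_lintegral_rpow_enorm_toReal h0 hp, eLpNorm_eq_lintegral_rpow_enorm_toReal h0 hp,
      hS.setLIntegral_eq hS' _ fun t x => by rw [hinv]]
  have hPS' := hf.congr hPf
  -- Measurability of the sum is not visible on `S`; invariance carries it over from `S'`, where `P`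
  -- agrees with `f`.
  have hmeas := (hS.aestronglyMeasurable_on_iff hS' hinv).2 hPS'.1.1
  refine ⟨P, ⟨⟨hmeas, ?_⟩, ⟨hmeas, ?_⟩⟩, ?_, fun w hw => ?_⟩
  · rw [hnorm 1 (by simp) (by simp)]
    exact hPS'.1.2
  · rw [hnorm 2 (by simp) (by simp)]
    exact hPS'.2.2
  · rw [hnorm 2 (by simp) (by simp), eLpNorm_congr_ae hPf]
  · rw [fourierOn_congr hS'.nullMeasurableSet hPf, fourierOn_eq_setIntegral hS.nullMeasurableSet,
      fourierOn_eq_setIntegral hS'.nullMeasurableSet]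
    refine hS.setIntegral_eq hS' fun t x => ?_
    rw [fourierChar_neg_inner_vadd hw, hinv]

/-- All fundamental domains of `T` have the same pair measures carried by the dual set. -/
theorem IsPairMeasure.of_isAddFundamentalDomain [Countable T]
    (hS : IsAddFundamentalDomain T S volume) (hS' : IsAddFundamentalDomain T S' volume)
    (hμ : μ (dualSet T)ᶜ = 0) (h : IsPairMeasure S μ) : IsPairMeasure S' μ := by
  have hae : ∀ᵐ w ∂μ, w ∈ dualSet T := hμ
  refine ⟨h.radon, fun f hf => ?_, fun f hf => ?_, h.dense_range.mono ?_⟩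
  · obtain ⟨P, hP, -, hF⟩ := exists_periodization hS hS' hf
    exact (h.memLp P hP).ae_eq (hae.mono hF)
  · obtain ⟨P, hP, hn, hF⟩ := exists_periodization hS hS' hf
    rw [← hn, ← h.isometric P hP]
    exact (eLpNorm_congr_ae (hae.mono hF)).symm
  · rintro g ⟨f, hf, hg⟩
    obtain ⟨P, hP, -, hF⟩ := exists_periodization hS' hS hf
    refine ⟨P, hP, hg.trans (hae.mono fun w hw => (hF w hw).symm)⟩

theorem fourier_comp_sub_right (t w : EuclideanSpace ℝ (Fin d)) :
    𝓕 (fun x => f (x - t)) w = 𝐞 (-⟪t, w⟫) • 𝓕 f w := by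
  simp only [Real.fourier_eq]
  simp only [Circle.smul_def]
  rw [← integral_add_right_eq_self _ t, ← integral_smul]
  congr 1
  ext v
  rw [add_sub_cancel_right, smul_smul, ← Circle.coe_mul, ← AddChar.map_add_eq_mul, inner_add_left,
    neg_add_rev, add_comm]

theorem inL1L2_indicator_one (hs : NullMeasurableSet S volume) (hfin : volume S ≠ ∞) :
    InL1L2 Ω (S.indicator (1 : EuclideanSpace ℝ (Fin d) → ℂ)) := by
  have : ∀ p : ℝ≥0∞, MemLp (S.indicator (1 : EuclideanSpace ℝ (Fin d) → ℂ)) p volume := by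
    intro p
    obtain ⟨S', -, hS', hSS'⟩ := hs.exists_measurable_superset_ae_eq
    refine (memLp_indicator_const p hS' (1 : ℂ) (.inr ?_)).ae_eq ?_
    · rwa [measure_congr hSS']
    · exact indicator_ae_eq_of_ae_eq_set hSS'
  exact ⟨(this 1).restrict Ω, (this 2).restrict Ω⟩

theorem InL1L2.sub (hf : InL1L2 Ω f) (hg : InL1L2 Ω g) : InL1L2 Ω (f - g) :=
  ⟨hf.1.sub hg.1, hf.2.sub hg.2⟩

/-- If the Fourier transform is isometric then the translates of `Ω` are disjoint. -/
theorem IsPairMeasure.aedisjoint_vadd (hΩ : NullMeasurableSet Ω volume)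
    (hμ : μ (dualSet T)ᶜ = 0) (h : IsPairMeasure Ω μ) {t : T} (ht : t ≠ 0) :
    AEDisjoint volume (t +ᵥ Ω) Ω := by
  have hae : ∀ᵐ w ∂μ, w ∈ dualSet T := hμ
  have ht0 : 0 < ‖(t : EuclideanSpace ℝ (Fin d))‖ := by simpa using ht
  rw [AEDisjoint]
  refine measure_null_of_locally_null _ fun x _ => ?_
  -- Two points of a ball of radius `‖t‖ / 2` are less than `‖t‖` apart, so a piece `U` of this ball
  -- is disjoint from `U - t`; it also has finite measure.
  set r := ‖(t : EuclideanSpace ℝ (Fin d))‖ / 2 with hr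
  set U := ((t +ᵥ Ω) ∩ Ω) ∩ Metric.ball x r with hU
  refine ⟨U, inter_mem self_mem_nhdsWithin
    (mem_nhdsWithin_of_mem_nhds (Metric.ball_mem_nhds x (by positivity))), ?_⟩
  have hUm : NullMeasurableSet U volume :=
    ((hΩ.vadd t).inter hΩ).inter measurableSet_ball.nullMeasurableSet
  have hUfin : volume U ≠ ∞ :=
    ((measure_mono inter_subset_right).trans_lt measure_ball_lt_top).ne
  set V := (-t) +ᵥ U with hV
  have hVm : NullMeasurableSet V volume := hUm.vadd (-t)
  have hVfin : volume V ≠ ∞ := by rwa [hV, measure_vadd]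
  have hmemV : ∀ y, y ∈ V ↔ y + (t : EuclideanSpace ℝ (Fin d)) ∈ U := by
    intro y
    rw [hV, Set.mem_vadd_set_iff_neg_vadd_mem, neg_neg, AddSubgroup.vadd_def, vadd_eq_add, add_comm]
  have hUΩ : U ⊆ Ω := fun y hy => hy.1.2
  have hVΩ : V ⊆ Ω := by
    intro y hy
    have := ((hmemV y).1 hy).1.1
    rw [Set.mem_vadd_set_iff_neg_vadd_mem, AddSubgroup.vadd_def, vadd_eq_add] at this
    simpa using this
  have hUV : ∀ y ∈ U, y ∉ V := by
    intro y hy hy'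
    have h1 := hy.2
    have h2 := ((hmemV y).1 hy').2
    rw [Metric.mem_ball] at h1 h2
    have h3 := dist_triangle_left (y + (t : EuclideanSpace ℝ (Fin d))) y x
    rw [dist_self_add_left, dist_comm x, dist_comm x] at h3
    linarith
  set uU : EuclideanSpace ℝ (Fin d) → ℂ := U.indicator 1 with huU
  set uV : EuclideanSpace ℝ (Fin d) → ℂ := V.indicator 1 with huV
  have hU1 : InL1L2 Ω uU := inL1L2_indicator_one hUm hUfin
  have hV1 : InL1L2 Ω uV := inL1L2_indicator_one hVm hVfin
  have hindU : Ω.indicator uU = uU := by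
    rw [huU, indicator_indicator, inter_eq_right.2 hUΩ]
  have hindV : Ω.indicator uV = uV := by
    rw [huV, indicator_indicator, inter_eq_right.2 hVΩ]
  have hiU := hU1.integrable_indicator hΩ
  have hiV := hV1.integrable_indicator hΩ
  rw [hindU] at hiU
  rw [hindV] at hiV
  have huUV : uU = fun x => uV (x - t) := by
    ext y
    by_cases hy : y ∈ U
    · rw [huU, huV, indicator_of_mem hy, indicator_of_mem]
      · rfl
      · rw [hmemV]; simpa
    · rw [huU, huV, indicator_of_notMem hy, indicator_of_notMem]
      rw [hmemV]; simpa
  -- The two transforms differ by the phase of the translation `t`, which is `1` on the dual set.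
  have hzero : ∀ w ∈ dualSet T, fourierOn Ω (uU - uV) w = 0 := by
    intro w hw
    have h1 : 𝓕 uU w = 𝓕 uV w := by
      rw [huUV, fourier_comp_sub_right]
      have := fourierChar_neg_inner_vadd hw t 0
      rw [AddSubgroup.vadd_def, vadd_eq_add, add_zero, inner_zero_left, neg_zero,
        AddChar.map_zero_eq_one] at this
      rw [this, one_smul]
    rw [fourierOn, indicator_sub', hindU, hindV]
    have h2 : 𝓕 (uU - uV) w = 𝓕 uU w - 𝓕 uV w := by
      simp only [Real.fourier_eq, Pi.sub_apply, smul_sub]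
      exact integral_sub ((Real.fourierIntegral_convergent_iff w).2 hiU)
        ((Real.fourierIntegral_convergent_iff w).2 hiV)
    rw [h2, h1, sub_self]
  have hiso := h.isometric _ (hU1.sub hV1)
  rw [eLpNorm_congr_ae (g := 0) (hae.mono hzero), eLpNorm_zero, eq_comm,
    eLpNorm_eq_zero_iff (hU1.sub hV1).2.1 (by simp)] at hiso
  have hae' : ∀ᵐ y ∂(volume.restrict U), (uU - uV) y = 0 :=
    ae_restrict_of_ae_restrict_of_subset hUΩ hiso
  rw [ae_restrict_iff'₀ hUm] at hae'
  rw [measure_eq_zero_iff_ae_notMem]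
  filter_upwards [hae'] with y hy hyU
  have := hy hyU
  simp [huU, huV, hyU, hUV y hyU] at this

/-- The part of a fundamental domain `D` which is missed by the translates of `Ω`. -/
def missedPart (T : AddSubgroup (EuclideanSpace ℝ (Fin d)))
    (Ω D : Set (EuclideanSpace ℝ (Fin d))) : Set (EuclideanSpace ℝ (Fin d)) :=
  D \ ⋃ t : T, t +ᵥ Ω

theorem nullMeasurableSet_missedPart [Countable T] (hΩ : NullMeasurableSet Ω volume)
    (hS : NullMeasurableSet S volume) : NullMeasurableSet (missedPart T Ω S) volume :=
  hS.diff (.iUnion fun t => hΩ.vadd t)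

/-- The missed part avoids every translate of `Ω`, and its own translates are disjoint because it
lies in `S`. A point moved into `S` is either in the missed part or can be moved on into `Ω`. -/
theorem isAddFundamentalDomain_union_missedPart [Countable T] (hΩ : NullMeasurableSet Ω volume)
    (hdisj : ∀ t : T, t ≠ 0 → AEDisjoint volume (t +ᵥ Ω) Ω)
    (hS : IsAddFundamentalDomain T S volume) :
    IsAddFundamentalDomain T (Ω ∪ missedPart T Ω S) volume := by
  refine .mk'' (hΩ.union (nullMeasurableSet_missedPart hΩ hS.nullMeasurableSet)) ?_ ?_
    fun t => (measurePreserving_vadd t volume).quasiMeasurePreserving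
  · filter_upwards [hS.ae_covers] with x ⟨t, ht⟩
    by_cases hx : t +ᵥ x ∈ ⋃ t : T, t +ᵥ Ω
    · obtain ⟨s, hs⟩ := mem_iUnion.1 hx
      rw [Set.mem_vadd_set_iff_neg_vadd_mem, ← add_vadd] at hs
      exact ⟨_, .inl hs⟩
    · exact ⟨t, .inr ⟨ht, hx⟩⟩
  · intro t ht
    rw [Set.vadd_set_union]
    have h1 : AEDisjoint volume (t +ᵥ Ω) (missedPart T Ω S) := by
      refine Disjoint.aedisjoint (Set.disjoint_left.2 fun x hx hx' => hx'.2 ?_)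
      exact mem_iUnion.2 ⟨t, hx⟩
    have h2 : AEDisjoint volume (t +ᵥ missedPart T Ω S) Ω := by
      refine Disjoint.aedisjoint (Set.disjoint_left.2 fun x hx hx' => ?_)
      rw [Set.mem_vadd_set_iff_neg_vadd_mem] at hx
      refine hx.2 (mem_iUnion.2 ⟨-t, ?_⟩)
      rw [Set.mem_vadd_set_iff_neg_vadd_mem]
      simpa using hx'
    have h3 : AEDisjoint volume (t +ᵥ missedPart T Ω S) (missedPart T Ω S) := by
      have := hS.aedisjoint ht
      simp only [Function.onFun, zero_vadd] at this
      exact this.mono (Set.vadd_set_mono sdiff_subset) sdiff_subset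
    rw [AEDisjoint.union_left_iff, AEDisjoint.union_right_iff, AEDisjoint.union_right_iff]
    exact ⟨⟨hdisj t ht, h1⟩, h2, h3⟩

theorem InL1L2.indicator_of_subset (hΩ : NullMeasurableSet Ω volume) (hf : InL1L2 Ω f) :
    InL1L2 S (Ω.indicator f) :=
  ⟨((memLp_indicator_iff_restrict₀ hΩ).2 hf.1).restrict S,
    ((memLp_indicator_iff_restrict₀ hΩ).2 hf.2).restrict S⟩

/-- If the Fourier transform has dense range then the translates of `Ω` cover. -/
theorem IsPairMeasure.volume_missedPart [Countable T] (hΩ : NullMeasurableSet Ω volume)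
    (h : IsPairMeasure Ω μ) (hS : NullMeasurableSet S volume)
    (h' : IsPairMeasure (Ω ∪ missedPart T Ω S) μ) : volume (missedPart T Ω S) = 0 := by
  set W := missedPart T Ω S with hW
  have hWm : NullMeasurableSet W volume := nullMeasurableSet_missedPart hΩ hS
  refine measure_null_of_locally_null _ fun x _ => ?_
  set V := W ∩ Metric.ball x 1 with hV
  refine ⟨V, inter_mem self_mem_nhdsWithin
    (mem_nhdsWithin_of_mem_nhds (Metric.ball_mem_nhds x (by positivity))), ?_⟩
  have hVm : NullMeasurableSet V volume := hWm.inter measurableSet_ball.nullMeasurableSet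
  have hVfin : volume V ≠ ∞ :=
    ((measure_mono inter_subset_right).trans_lt measure_ball_lt_top).ne
  have hVW : V ⊆ W := inter_subset_left
  have hVΩ : ∀ y ∈ V, y ∉ Ω := by
    intro y hy hyΩ
    refine (hVW hy).2 (mem_iUnion.2 ⟨0, ?_⟩)
    simpa using hyΩ
  have hΩ'm : NullMeasurableSet (Ω ∪ W) volume := hΩ.union hWm
  set u : EuclideanSpace ℝ (Fin d) → ℂ := V.indicator 1 with hu
  have hu1 : InL1L2 (Ω ∪ W) u := inL1L2_indicator_one hVm hVfin
  have huL := h'.memLp u hu1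
  by_contra hV0
  -- Isometry on the enlarged set turns the distance of transforms into a distance of functions,
  -- which is bounded below by its contribution on `V`, where `f` extended by zero vanishes.
  have hlow : ∀ f, InL1L2 Ω f → eLpNorm (1 : EuclideanSpace ℝ (Fin d) → ℂ) 2 (volume.restrict V) ≤
      eLpNorm (fourierOn (Ω ∪ W) u - fourierOn Ω f) 2 μ := by
    intro f hf
    have hf' : InL1L2 (Ω ∪ W) (Ω.indicator f) := hf.indicator_of_subset hΩ
    have e1 : fourierOn Ω f = fourierOn (Ω ∪ W) (Ω.indicator f) := by
      rw [fourierOn, fourierOn, indicator_indicator, inter_eq_right.2 subset_union_left]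
    have e2 : fourierOn (Ω ∪ W) u - fourierOn (Ω ∪ W) (Ω.indicator f) =
        fourierOn (Ω ∪ W) (u - Ω.indicator f) := by
      ext w
      rw [Pi.sub_apply, fourierOn, fourierOn, fourierOn, indicator_sub']
      simp only [Real.fourier_eq, Pi.sub_apply, smul_sub]
      exact (integral_sub
        ((Real.fourierIntegral_convergent_iff w).2 (hu1.integrable_indicator hΩ'm))
        ((Real.fourierIntegral_convergent_iff w).2 (hf'.integrable_indicator hΩ'm))).symm
    rw [e1, e2, h'.isometric _ (hu1.sub hf')]
    calc eLpNorm (1 : EuclideanSpace ℝ (Fin d) → ℂ) 2 (volume.restrict V)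
        = eLpNorm (u - Ω.indicator f) 2 (volume.restrict V) := by
          refine eLpNorm_congr_ae ?_
          rw [EventuallyEq, ae_restrict_iff'₀ hVm]
          filter_upwards with y hy
          simp [hu, hy, hVΩ y hy]
      _ ≤ _ := eLpNorm_mono_measure _
          (Measure.restrict_mono (hVW.trans subset_union_right) le_rfl)
  set ε := eLpNorm (1 : EuclideanSpace ℝ (Fin d) → ℂ) 2 (volume.restrict V) with hε
  have hε0 : 0 < ε := by
    rw [pos_iff_ne_zero, hε, ne_eq, eLpNorm_eq_zero_iff aestronglyMeasurable_one (by simp)]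
    intro h0
    rw [EventuallyEq, ae_restrict_iff'₀ hVm] at h0
    refine hV0 (measure_eq_zero_iff_ae_notMem.2 ?_)
    filter_upwards [h0] with y hy hyV
    simpa using hy hyV
  -- By `hlow` this ball contains no transform of a function on `Ω`, contradicting density.
  have hball : Metric.eball huL.toLp ε ∈ 𝓝 huL.toLp := Metric.eball_mem_nhds _ hε0
  obtain ⟨g, ⟨f, hf, hgf⟩, hgb⟩ := h.dense_range.inter_nhds_nonempty hball
  have h1 : edist g huL.toLp < ε := hgb
  rw [edist_comm, Lp.edist_def, eLpNorm_congr_ae (huL.coeFn_toLp.sub hgf)] at h1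
  exact absurd (hlow f hf) (not_le.2 h1)

/-- A set with the same pair measure as a fundamental domain is a fundamental domain. -/
theorem IsPairMeasure.isAddFundamentalDomain [Countable T] (hΩ : NullMeasurableSet Ω volume)
    (hμ : μ (dualSet T)ᶜ = 0) (h : IsPairMeasure Ω μ)
    (hS : IsAddFundamentalDomain T S volume) (hSμ : IsPairMeasure S μ) :
    IsAddFundamentalDomain T Ω volume := by
  have hdisj : ∀ t : T, t ≠ 0 → AEDisjoint volume (t +ᵥ Ω) Ω :=
    fun t ht => h.aedisjoint_vadd hΩ hμ ht
  have hU := isAddFundamentalDomain_union_missedPart hΩ hdisj hS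
  have h0 := h.volume_missedPart hΩ hS.nullMeasurableSet
    (hSμ.of_isAddFundamentalDomain hS hU hμ)
  refine .mk'' hΩ ?_ hdisj fun t => (measurePreserving_vadd t volume).quasiMeasurePreserving
  have hall : ∀ᵐ x, ∀ t : T, t +ᵥ x ∉ missedPart T Ω S := by
    rw [ae_all_iff]
    intro t
    exact (measurePreserving_vadd t volume).quasiMeasurePreserving.ae
      (measure_eq_zero_iff_ae_notMem.1 h0)
  filter_upwards [hall, hU.ae_covers] with x hx ⟨t, ht⟩
  exact ⟨t, ht.resolve_right (hx t)⟩

end FundamentalDomain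

open scoped SchwartzMap
-- Plancherel's theorem on `L¹ ∩ L²`
section Plancherel

variable {V : Type*} [NormedAddCommGroup V] [InnerProductSpace ℝ V] [FiniteDimensional ℝ V]
  [MeasurableSpace V] [BorelSpace V]

theorem integral_smul_fourier_eq {f g : V → ℂ} (hf : Integrable f) (hg : Integrable g) :
    ∫ x, g x • 𝓕 f x = ∫ x, 𝓕 g x • f x := by
  have := VectorFourier.integral_fourierIntegral_smul_eq_flip (μ := (volume : Measure V))
    (ν := (volume : Measure V)) (L := innerₗ V) Real.continuous_fourierChar
    (by simpa using continuous_inner) hg hf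
  rw [flip_innerₗ] at this
  exact this.symm

/-- **Plancherel's theorem** for the classical Fourier transform of a function in `L¹ ∩ L²`. -/
theorem eLpNorm_fourier_eq {f : V → ℂ} (h1 : Integrable f) (h2 : MemLp f 2) :
    eLpNorm (𝓕 f) 2 volume = eLpNorm f 2 volume := by
  have hcont : Continuous (𝓕 f) :=
    VectorFourier.fourierIntegral_continuous Real.continuous_fourierChar
      (by simpa using continuous_inner) h1
  -- The `L²` transform, defined by extension, is identified with the integral by testing on smooth
  -- compactly supported functions: in both cases the transform moves onto the test function.
  have key : ∀ᵐ x, (𝓕 h2.toLp : Lp ℂ 2 (volume : Measure V)) x = 𝓕 f x := by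
    refine ae_eq_of_integral_contDiff_smul_eq
      ((Lp.memLp _).locallyIntegrable (by norm_num)) hcont.locallyIntegrable fun g hg hgc => ?_
    have hgc' : HasCompactSupport (fun x => (g x : ℂ)) :=
      hgc.comp_left Complex.ofReal_zero
    have hg' : ContDiff ℝ ((⊤ : ℕ∞) : WithTop ℕ∞) (fun x => (g x : ℂ)) :=
      Complex.ofRealCLM.contDiff.comp hg
    set ψ : 𝓢(V, ℂ) := hgc'.toSchwartzMap hg' with hψ
    have hval : ∀ x, ψ x = g x := fun x => rfl
    have e1 := congrArg (fun τ => τ ψ) (Lp.fourier_toTemperedDistribution_eq h2.toLp)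
    simp only [TemperedDistribution.fourier_apply, Lp.toTemperedDistribution_apply] at e1
    have e2 : ∀ u : V → ℂ, ∫ x, g x • u x = ∫ x, ψ x • u x := fun u => by
      congr 1
    rw [e2, e2, ← e1, integral_smul_fourier_eq h1 ψ.integrable]
    apply integral_congr_ae
    filter_upwards [h2.coeFn_toLp] with x hx
    rw [hx, SchwartzMap.fourier_coe]
  have hn := Lp.norm_fourier_eq h2.toLp
  rw [Lp.norm_def, Lp.norm_def, eLpNorm_congr_ae key, eLpNorm_congr_ae h2.coeFn_toLp] at hn
  refine (ENNReal.toReal_eq_toReal_iff' ?_ h2.2.ne).1 hn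
  rw [← eLpNorm_congr_ae key]
  exact (Lp.memLp _).2.ne

end Plancherel

/-! ### Parseval's identity on the unit cube -/

section UnitCube

variable {k : ℕ}

/-- The half-open unit cube. -/
def unitCube (k : ℕ) : Set (Fin k → ℝ) := {x | ∀ i, x i ∈ Ioc (0 : ℝ) 1}

theorem measurableSet_unitCube : MeasurableSet (unitCube k) :=
  MeasurableSet.univ_pi' fun _ => measurableSet_Ioc

theorem unitCube_eq_pi : unitCube k = Set.univ.pi fun _ => Ioc (0 : ℝ) 1 := by
  ext x
  simp [unitCube]

theorem volume_unitCube : volume (unitCube k) = 1 := by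
  rw [unitCube_eq_pi, Real.volume_pi_Ioc]
  simp

theorem sq_enorm_eq_ofReal (z : ℂ) : ‖z‖ₑ ^ 2 = ENNReal.ofReal (‖z‖ ^ 2) := by
  rw [← ofReal_norm, ENNReal.ofReal_pow (norm_nonneg _)]

theorem eLpNorm_two_eq_lintegral_sq {α : Type*} [MeasurableSpace α] {ν : Measure α} {f : α → ℂ} :
    eLpNorm f 2 ν = (∫⁻ x, ‖f x‖ₑ ^ 2 ∂ν) ^ (1 / 2 : ℝ) := by
  rw [eLpNorm_two_eq_lintegral]
  simp_rw [ENNReal.rpow_two]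

theorem lintegral_sq_eq_of_eLpNorm_two_eq {α β : Type*} [MeasurableSpace α] [MeasurableSpace β]
    {ν : Measure α} {ν' : Measure β} {f : α → ℂ} {g : β → ℂ} (h : eLpNorm f 2 ν = eLpNorm g 2 ν') :
    ∫⁻ x, ‖f x‖ₑ ^ 2 ∂ν = ∫⁻ x, ‖g x‖ₑ ^ 2 ∂ν' := by
  rw [eLpNorm_two_eq_lintegral_sq, eLpNorm_two_eq_lintegral_sq] at h
  exact ENNReal.rpow_left_injective (by norm_num) h

noncomputable local instance : MeasureSpace UnitAddCircle := ⟨AddCircle.haarAddCircle⟩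

local instance : Measure.IsAddHaarMeasure (volume : Measure UnitAddCircle) :=
  inferInstanceAs (Measure.IsAddHaarMeasure AddCircle.haarAddCircle)

local instance : IsProbabilityMeasure (volume : Measure UnitAddCircle) :=
  inferInstanceAs (IsProbabilityMeasure AddCircle.haarAddCircle)

theorem mFourier_coe (n : Fin k → ℤ) (x : Fin k → ℝ) :
    UnitAddTorus.mFourier n (fun i => (x i : UnitAddCircle)) = 𝐞 (∑ i, (n i : ℝ) * x i) := by
  rw [Real.fourierChar_apply]
  simp only [UnitAddTorus.mFourier, ContinuousMap.coe_mk, fourier_coe_apply]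
  rw [← Complex.exp_sum]
  congr 1
  push_cast
  rw [Finset.mul_sum, Finset.sum_mul]
  refine Finset.sum_congr rfl fun i _ => ?_
  ring

theorem mFourierCoeff_eq_integral_unitCube (G : UnitAddTorus (Fin k) → ℂ) (n : Fin k → ℤ) :
    UnitAddTorus.mFourierCoeff G n =
      ∫ x in unitCube k, 𝐞 (-∑ i, (n i : ℝ) * x i) • G (fun i => (x i : UnitAddCircle)) := by
  rw [UnitAddTorus.mFourierCoeff_eq_integral G n 0]
  simp only [Pi.zero_apply, zero_add]
  refine integral_congr_ae (.of_forall fun x => ?_)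
  simp only [Circle.smul_def]
  rw [mFourier_coe]
  simp

/-- Parseval on the torus, transported by the measure-preserving identification of the torus with
the half-open cube. -/
theorem tsum_sq_integral_unitCube {u : (Fin k → ℝ) → ℂ}
    (hu : MemLp u 2 (volume.restrict (unitCube k))) :
    ∑' n : Fin k → ℤ, ‖∫ x in unitCube k, 𝐞 (-∑ i, (n i : ℝ) * x i) • u x‖ₑ ^ 2 =
      ∫⁻ x in unitCube k, ‖u x‖ₑ ^ 2 := by
  have hmeas : MeasurableSet {x : Fin k → ℝ | ∀ i, x i ∈ Ioc ((0 : Fin k → ℝ) i)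
      ((0 : Fin k → ℝ) i + 1)} := MeasurableSet.univ_pi' fun _ => measurableSet_Ioc
  set e := UnitAddTorus.measurableEquivPiIoc (0 : Fin k → ℝ) with he
  have hset : {x : Fin k → ℝ | ∀ i, x i ∈ Ioc ((0 : Fin k → ℝ) i) ((0 : Fin k → ℝ) i + 1)} =
      unitCube k := by
    simp [unitCube]
  set G : UnitAddTorus (Fin k) → ℂ := fun t => u (e t) with hG
  have hGu : ∀ x ∈ unitCube k, G (fun i => (x i : UnitAddCircle)) = u x := by
    intro x hx
    rw [← hset] at hx
    have : e (fun i => (x i : UnitAddCircle)) = ⟨x, hx⟩ := e.apply_symm_apply ⟨x, hx⟩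
    rw [hG]
    dsimp only
    rw [this]
  have hGL : MemLp G 2 volume := by
    have h1 : MemLp u 2 (Measure.map Subtype.val (Measure.comap (Subtype.val :
        {x : Fin k → ℝ // ∀ i, x i ∈ Ioc ((0 : Fin k → ℝ) i) ((0 : Fin k → ℝ) i + 1)} →
          (Fin k → ℝ)) volume)) := by
      convert! hu
      rw [← hset]
      exact map_comap_subtype_coe hmeas volume
    have h2 := h1.comp_of_map measurable_subtype_coe.aemeasurable
    exact h2.comp_measurePreserving (UnitAddTorus.measurePreserving_equivPiIoc 0)
  have hcoeff : ∀ n, UnitAddTorus.mFourierCoeff hGL.toLp n =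
      ∫ x in unitCube k, 𝐞 (-∑ i, (n i : ℝ) * x i) • u x := by
    intro n
    have : UnitAddTorus.mFourierCoeff hGL.toLp n = UnitAddTorus.mFourierCoeff G n := by
      apply integral_congr_ae
      filter_upwards [hGL.coeFn_toLp] with t ht
      rw [ht]
    rw [this, mFourierCoeff_eq_integral_unitCube]
    refine setIntegral_congr_fun measurableSet_unitCube fun x hx => ?_
    simp only [hGu x hx]
  have hsum := UnitAddTorus.hasSum_sq_mFourierCoeff hGL.toLp
  simp only [hcoeff] at hsum
  simp only [sq_enorm_eq_ofReal]
  rw [← ENNReal.ofReal_tsum_of_nonneg (fun _ => by positivity) hsum.summable, hsum.tsum_eq,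
    ofReal_integral_eq_lintegral_ofReal ((Lp.memLp _).integrable_norm_pow (by simp))
      (.of_forall fun _ => by positivity)]
  rw [lintegral_congr_ae (g := fun t => ENNReal.ofReal (‖G t‖ ^ 2))
    (by filter_upwards [hGL.coeFn_toLp] with t ht; rw [ht]), UnitAddTorus.lintegral_preimage _ 0,
    hset]
  refine setLIntegral_congr_fun measurableSet_unitCube fun x hx => ?_
  simp only [hGu x hx]

theorem integral_unitCube_fourierChar (m n : Fin k → ℤ) :
    ∫ x in unitCube k, 𝐞 (-∑ i, (m i : ℝ) * x i) • (𝐞 (∑ i, (n i : ℝ) * x i) : ℂ) =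
      if m = n then 1 else 0 := by
  have h1 := UnitAddTorus.mFourierBasis_repr
    (UnitAddTorus.mFourierLp (d := Fin k) 2 n) m
  rw [UnitAddTorus.mFourierCoeff_toLp, mFourierCoeff_eq_integral_unitCube] at h1
  simp only [mFourier_coe] at h1
  rw [← h1, ← UnitAddTorus.coe_mFourierBasis, HilbertBasis.repr_self]
  simp [lp.single_apply, Pi.single_apply]

end UnitCube

/-! ### Fourier series in the cube combined with the Fourier transform in `V` -/

section MixedFourier

variable {k : ℕ} {V : Type*} [NormedAddCommGroup V] [InnerProductSpace ℝ V]
  [FiniteDimensional ℝ V] [MeasurableSpace V] [BorelSpace V] {g : (Fin k → ℝ) × V → ℂ}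

variable (k V) in
/-- Lebesgue measure on the product of the unit cube with `V`. -/
noncomputable def cubeProdMeasure : Measure ((Fin k → ℝ) × V) :=
  (volume.restrict (unitCube k)).prod volume

/-- The Fourier transform of a function on `[0,1]^k × V`, as a function on `ℤ^k × V`. -/
noncomputable def mixedFourier (g : (Fin k → ℝ) × V → ℂ) (n : Fin k → ℤ) (ξ : V) : ℂ :=
  ∫ p, 𝐞 (-(∑ i, (n i : ℝ) * p.1 i + ⟪p.2, ξ⟫)) • g p ∂cubeProdMeasure k V

/-- The partial Fourier coefficient of a function on `[0,1]^k × V` in the first variable. -/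
noncomputable def cubeCoeff (g : (Fin k → ℝ) × V → ℂ) (n : Fin k → ℤ) (y : V) : ℂ :=
  ∫ x in unitCube k, 𝐞 (-∑ i, (n i : ℝ) * x i) • g (x, y)

theorem integrable_fourierChar_smul {X : Type*} [TopologicalSpace X] [MeasurableSpace X]
    [OpensMeasurableSpace X] [SecondCountableTopology X] {ν : Measure X} {g : X → ℂ} {φ : X → ℝ}
    (hφ : Continuous φ) (hg : Integrable g ν) : Integrable (fun p => 𝐞 (φ p) • g p) ν := by
  have hc : Continuous fun p => (𝐞 (φ p) : ℂ) :=
    continuous_subtype_val.comp (Real.continuous_fourierChar.comp hφ)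
  refine hg.mono (hc.aestronglyMeasurable.smul hg.1) (.of_forall fun p => ?_)
  rw [Circle.norm_smul]

theorem integrable_cubeCoeff (hg : Integrable g (cubeProdMeasure k V)) (n : Fin k → ℤ) :
    Integrable (cubeCoeff g n) :=
  (integrable_fourierChar_smul (φ := fun p : (Fin k → ℝ) × V => -∑ i, (n i : ℝ) * p.1 i)
    (by fun_prop) hg).integral_prod_right

theorem mixedFourier_eq (hg : Integrable g (cubeProdMeasure k V)) (n : Fin k → ℤ) :
    mixedFourier g n = 𝓕 (cubeCoeff g n) := by
  ext ξ
  rw [mixedFourier, cubeProdMeasure, integral_prod_symm _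
    (integrable_fourierChar_smul (by fun_prop) hg), Real.fourier_eq]
  congr 1
  ext y
  rw [cubeCoeff, Circle.smul_def, ← integral_smul]
  congr 1
  ext x
  rw [← Circle.smul_def, smul_smul, ← AddChar.map_add_eq_mul]
  congr 2
  ring

theorem tsum_sq_cubeCoeff (hg : Integrable g (cubeProdMeasure k V))
    (hg2 : MemLp g 2 (cubeProdMeasure k V)) :
    ∀ᵐ y : V, ∑' n, ‖cubeCoeff g n y‖ₑ ^ 2 = ∫⁻ x in unitCube k, ‖g (x, y)‖ₑ ^ 2 := by
  have hsq : Integrable (fun p => ‖g p‖ ^ 2) (cubeProdMeasure k V) :=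
    hg2.integrable_norm_pow (by simp)
  filter_upwards [hg.prod_left_ae, hsq.prod_left_ae] with y h1 h2
  exact tsum_sq_integral_unitCube ((memLp_two_iff_integrable_sq_norm h1.1).2 h2)

/-- Plancherel in `V` for each coefficient, then Tonelli, then Parseval on almost every slice. The
total being finite also puts each coefficient in `L²`, as Plancherel requires. -/
theorem tsum_lintegral_sq_mixedFourier (hg : Integrable g (cubeProdMeasure k V))
    (hg2 : MemLp g 2 (cubeProdMeasure k V)) :
    ∑' n, ∫⁻ ξ, ‖mixedFourier g n ξ‖ₑ ^ 2 = ∫⁻ p, ‖g p‖ₑ ^ 2 ∂cubeProdMeasure k V := by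
  have hmeas : ∀ n, AEMeasurable (fun y => ‖cubeCoeff g n y‖ₑ ^ 2) :=
    fun n => (integrable_cubeCoeff hg n).1.enorm.pow_const 2
  have htot : ∑' n, ∫⁻ y, ‖cubeCoeff g n y‖ₑ ^ 2 = ∫⁻ p, ‖g p‖ₑ ^ 2 ∂cubeProdMeasure k V := by
    rw [← lintegral_tsum hmeas, lintegral_congr_ae (tsum_sq_cubeCoeff hg hg2), cubeProdMeasure,
      lintegral_prod_symm _ (hg.1.enorm.pow_const 2)]
  have hfin : ∫⁻ p, ‖g p‖ₑ ^ 2 ∂cubeProdMeasure k V < ∞ := by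
    have := eLpNorm_lt_top_iff_lintegral_rpow_enorm_lt_top (by simp) (by simp) |>.1 hg2.2
    simpa using this
  rw [← htot]
  refine tsum_congr fun n => ?_
  rw [mixedFourier_eq hg]
  refine lintegral_sq_eq_of_eLpNorm_two_eq (eLpNorm_fourier_eq (integrable_cubeCoeff hg n)
    ⟨(integrable_cubeCoeff hg n).1, ?_⟩)
  rw [eLpNorm_lt_top_iff_lintegral_rpow_enorm_lt_top (by simp) (by simp)]
  simpa using (ENNReal.le_tsum n).trans_lt (htot.trans_lt hfin)

/-- The product of a character of `ℤ^k` with a Schwartz function. -/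
noncomputable def charMul (n : Fin k → ℤ) (φ : 𝓢(V, ℂ)) (p : (Fin k → ℝ) × V) : ℂ :=
  𝐞 (∑ i, (n i : ℝ) * p.1 i) • φ p.2

instance : IsFiniteMeasure (volume.restrict (unitCube k)) :=
  ⟨by simp [volume_unitCube]⟩

theorem memLp_charMul (n : Fin k → ℤ) (φ : 𝓢(V, ℂ)) (p : ℝ≥0∞) :
    MemLp (charMul n φ) p (cubeProdMeasure k V) := by
  have h1 : MemLp (fun p : (Fin k → ℝ) × V => φ p.2) p (cubeProdMeasure k V) := by
    have := (φ.memLp p volume).comp_snd (μ := volume.restrict (unitCube k))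
    exact this
  have hc : Continuous (charMul n φ) := by
    unfold charMul
    have : Continuous fun p : (Fin k → ℝ) × V => 𝐞 (∑ i, (n i : ℝ) * p.1 i) :=
      Real.continuous_fourierChar.comp (by fun_prop)
    exact this.smul (φ.continuous.comp continuous_snd)
  refine h1.mono hc.aestronglyMeasurable (.of_forall fun p => ?_)
  rw [charMul, Circle.norm_smul]

theorem integrable_charMul (n : Fin k → ℤ) (φ : 𝓢(V, ℂ)) :
    Integrable (charMul n φ) (cubeProdMeasure k V) :=
  memLp_one_iff_integrable.1 (memLp_charMul n φ 1)

/-- Orthogonality of characters leaves a single frequency, so an arbitrary Schwartz function can be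
realised on one copy of `V` with zero on all others; density rests on this. -/
theorem mixedFourier_charMul (m n : Fin k → ℤ) (φ : 𝓢(V, ℂ)) (ξ : V) :
    mixedFourier (charMul n φ) m ξ = if m = n then 𝓕 φ ξ else 0 := by
  have : cubeCoeff (charMul n φ) m = (if m = n then (1 : ℂ) else 0) • ⇑φ := by
    ext y
    rw [cubeCoeff, ← integral_unitCube_fourierChar, Pi.smul_apply, smul_eq_mul, ← integral_mul_const]
    congr 1
    ext x
    simp only [charMul, Circle.smul_def, smul_eq_mul, mul_assoc]
  rw [mixedFourier_eq (integrable_charMul n φ), this]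
  split_ifs with h
  · rw [one_smul, SchwartzMap.fourier_coe]
  · simp [Real.fourier_eq]

end MixedFourier

/-! ### Coordinates, the lattice, and the measure as a sum over affine sheets -/

section Coordinates

variable {d₁ d₂ : ℕ}

/-- The identification `(x₁, x₂) ↦ x` as a linear equivalence. -/
noncomputable def joinEquiv (d₁ d₂ : ℕ) :
    ((Fin d₁ → ℝ) × EuclideanSpace ℝ (Fin d₂)) ≃L[ℝ] EuclideanSpace ℝ (Fin (d₁ + d₂)) :=
  LinearEquiv.toContinuousLinearEquiv
    { toFun := fun p => joinCoords (WithLp.toLp 2 p.1, p.2)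
      invFun := fun v => (fun i => v (Fin.castAdd d₂ i), WithLp.toLp 2 fun j => v (Fin.natAdd d₁ j))
      map_add' := fun p q => by
        ext i
        refine Fin.addCases (fun i => ?_) (fun j => ?_) i <;> simp [joinCoords]
      map_smul' := fun c p => by
        ext i
        refine Fin.addCases (fun i => ?_) (fun j => ?_) i <;> simp [joinCoords]
      left_inv := fun p => by
        simp [joinCoords]
      right_inv := fun v => by
        ext i
        refine Fin.addCases (fun i => ?_) (fun j => ?_) i <;> simp [joinCoords] }

theorem continuous_joinCoords : Continuous (joinCoords (d₁ := d₁) (d₂ := d₂)) := by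
  have : joinCoords (d₁ := d₁) (d₂ := d₂) = joinEquiv d₁ d₂ ∘
      Prod.map (EuclideanSpace.equiv (Fin d₁) ℝ) id := by
    ext p
    rfl
  rw [this]
  exact (joinEquiv d₁ d₂).continuous.comp
    ((EuclideanSpace.equiv (Fin d₁) ℝ).continuous.prodMap continuous_id)

theorem map_joinEquiv_volume :
    Measure.map (joinEquiv d₁ d₂) (volume.prod volume) = volume := by
  have h1 : MeasurePreserving (Prod.map id (WithLp.toLp 2) :
      (Fin d₁ → ℝ) × (Fin d₂ → ℝ) → (Fin d₁ → ℝ) × EuclideanSpace ℝ (Fin d₂))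
      (volume.prod volume) (volume.prod volume) :=
    (MeasurePreserving.id volume).prod (PiLp.volume_preserving_toLp (Fin d₂))
  have hm : Measurable fun p : (Fin d₁ → ℝ) × (Fin d₂ → ℝ) => Fin.append p.1 p.2 := by
    refine measurable_pi_iff.2 fun i => ?_
    refine Fin.addCases (fun i => ?_) (fun j => ?_) i <;> simp only [Fin.append_left,
      Fin.append_right] <;> fun_prop
  have h2 : Measure.map (fun p : (Fin d₁ → ℝ) × (Fin d₂ → ℝ) => Fin.append p.1 p.2)
      (volume.prod volume) = volume := by
    refine (Measure.pi_eq fun s hs => ?_).symm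
    rw [Measure.map_apply hm (.univ_pi hs)]
    have : (fun p : (Fin d₁ → ℝ) × (Fin d₂ → ℝ) => Fin.append p.1 p.2) ⁻¹' Set.univ.pi s =
        (Set.univ.pi fun i => s (Fin.castAdd d₂ i)) ×ˢ
          (Set.univ.pi fun j => s (Fin.natAdd d₁ j)) := by
      ext p
      simp only [mem_preimage, mem_univ_pi, mem_prod]
      constructor
      · intro h
        exact ⟨fun i => by simpa using h (Fin.castAdd d₂ i),
          fun j => by simpa using h (Fin.natAdd d₁ j)⟩
      · rintro ⟨h, h'⟩ i
        refine Fin.addCases (fun i => ?_) (fun j => ?_) i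
        · simpa using h i
        · simpa using h' j
    rw [this, Measure.prod_prod, volume_pi_pi, volume_pi_pi, Fin.prod_univ_add]
  rw [← h1.map_eq, Measure.map_map (joinEquiv d₁ d₂).continuous.measurable h1.measurable,
    ← (PiLp.volume_preserving_toLp (Fin (d₁ + d₂))).map_eq, ← h2,
    Measure.map_map (PiLp.volume_preserving_toLp (Fin (d₁ + d₂))).measurable hm]
  rfl

theorem inner_joinCoords (x y : EuclideanSpace ℝ (Fin d₁)) (x' y' : EuclideanSpace ℝ (Fin d₂)) :
    ⟪joinCoords (x, x'), joinCoords (y, y')⟫ = ∑ i, y i * x i + ⟪x', y'⟫ := by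
  simp [PiLp.inner_apply, Fin.sum_univ_add, joinCoords]

theorem toEuclideanLin_mul_apply {n : ℕ} (B C : Matrix (Fin n) (Fin n) ℝ)
    (v : EuclideanSpace ℝ (Fin n)) : Matrix.toEuclideanLin B (Matrix.toEuclideanLin C v) =
      Matrix.toEuclideanLin (B * C) v := by
  simp [Matrix.toLpLin_apply]

theorem inner_toEuclideanLin_inv_transpose {n : ℕ} {A : Matrix (Fin n) (Fin n) ℝ}
    (hA : IsUnit A.det) (v w : EuclideanSpace ℝ (Fin n)) :
    ⟪Matrix.toEuclideanLin A v, Matrix.toEuclideanLin (Aᵀ)⁻¹ w⟫ = ⟪v, w⟫ := by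
  rw [EuclideanSpace.inner_eq_star_dotProduct, EuclideanSpace.inner_eq_star_dotProduct]
  simp only [Matrix.toLpLin_apply, star_trivial]
  rw [Matrix.dotProduct_mulVec, Matrix.vecMul_mulVec, Matrix.transpose_nonsing_inv,
    Matrix.transpose_transpose, Matrix.nonsing_inv_mul _ hA, Matrix.vecMul_one]

/-- The invertible matrix `A` as a linear equivalence. -/
noncomputable def matEquiv {n : ℕ} (A : Matrix (Fin n) (Fin n) ℝ) (hA : IsUnit A.det) :
    EuclideanSpace ℝ (Fin n) ≃L[ℝ] EuclideanSpace ℝ (Fin n) :=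
  LinearEquiv.toContinuousLinearEquiv <|
    LinearEquiv.ofLinearMap (Matrix.toEuclideanLin A) (Matrix.toEuclideanLin A⁻¹)
      (by
        ext1 v
        rw [LinearMap.comp_apply, toEuclideanLin_mul_apply, Matrix.mul_nonsing_inv _ hA]
        simp)
      (by
        ext1 v
        rw [LinearMap.comp_apply, toEuclideanLin_mul_apply, Matrix.nonsing_inv_mul _ hA]
        simp)

theorem det_toEuclideanLin {n : ℕ} (A : Matrix (Fin n) (Fin n) ℝ) :
    LinearMap.det (Matrix.toEuclideanLin A) = A.det := by
  change LinearMap.det (Matrix.toLpLin 2 2 A) = _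
  rw [Matrix.toLpLin_eq_toLin, LinearMap.det_toLin]

variable (A : Matrix (Fin (d₁ + d₂)) (Fin (d₁ + d₂)) ℝ) (hA : IsUnit A.det)

/-- The linear equivalence `(x₁, x₂) ↦ A x`. -/
noncomputable def latticeEquiv :
    ((Fin d₁ → ℝ) × EuclideanSpace ℝ (Fin d₂)) ≃L[ℝ] EuclideanSpace ℝ (Fin (d₁ + d₂)) :=
  (joinEquiv d₁ d₂).trans (matEquiv A hA)

theorem latticeEquiv_apply (p : (Fin d₁ → ℝ) × EuclideanSpace ℝ (Fin d₂)) :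
    latticeEquiv A hA p = Matrix.toEuclideanLin A (joinCoords (WithLp.toLp 2 p.1, p.2)) := rfl

/-- The point `(Aᵀ)⁻¹ (n, ξ)`. -/
noncomputable def dualPoint (n : Fin d₁ → ℤ) (ξ : EuclideanSpace ℝ (Fin d₂)) :
    EuclideanSpace ℝ (Fin (d₁ + d₂)) :=
  Matrix.toEuclideanLin (Aᵀ)⁻¹ (joinCoords (WithLp.toLp 2 fun i => (n i : ℝ), ξ))

variable {A}

theorem continuous_toEuclideanLin {n : ℕ} (B : Matrix (Fin n) (Fin n) ℝ) :
    Continuous (Matrix.toEuclideanLin B) :=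
  LinearMap.continuous_of_finiteDimensional _

theorem continuous_dualPoint (n : Fin d₁ → ℤ) : Continuous (dualPoint (d₂ := d₂) A n) :=
  (continuous_toEuclideanLin _).comp (continuous_joinCoords.comp (by fun_prop))

theorem inner_latticeEquiv_dualPoint (p : (Fin d₁ → ℝ) × EuclideanSpace ℝ (Fin d₂))
    (n : Fin d₁ → ℤ) (ξ : EuclideanSpace ℝ (Fin d₂)) :
    ⟪latticeEquiv A hA p, dualPoint A n ξ⟫ = ∑ i, (n i : ℝ) * p.1 i + ⟪p.2, ξ⟫ := by
  rw [latticeEquiv_apply, dualPoint, inner_toEuclideanLin_inv_transpose hA, inner_joinCoords]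

theorem mem_matSubgroup_iff {t : EuclideanSpace ℝ (Fin (d₁ + d₂))} :
    t ∈ matSubgroup A ↔ ∃ n : Fin d₁ → ℤ, latticeEquiv A hA (fun i => (n i : ℝ), 0) = t := by
  constructor
  · rintro ⟨x, ⟨hx, hx'⟩, rfl⟩
    choose n hn using hx
    refine ⟨n, ?_⟩
    rw [latticeEquiv_apply]
    change _ = Matrix.toEuclideanLin A x
    congr 1
    ext i
    refine Fin.addCases (fun i => ?_) (fun j => ?_) i
    · simp [joinCoords, hn]
    · simp [joinCoords, hx']
  · rintro ⟨n, rfl⟩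
    refine ⟨joinCoords (WithLp.toLp 2 fun i => (n i : ℝ), 0), ⟨fun i => ⟨n i, ?_⟩, fun j => ?_⟩, rfl⟩
    · simp [joinCoords]
    · simp [joinCoords]

theorem countable_matSubgroup (hA : IsUnit A.det) : Countable (matSubgroup (d₁ := d₁) (d₂ := d₂) A) := by
  have : (matSubgroup A : Set (EuclideanSpace ℝ (Fin (d₁ + d₂)))) ⊆
      range fun n : Fin d₁ → ℤ => latticeEquiv A hA (fun i => (n i : ℝ), 0) :=
    fun t ht => (mem_matSubgroup_iff hA).1 ht
  exact ((countable_range _).mono this).to_subtype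

theorem dualPoint_mem_dualSet (hA : IsUnit A.det) (n : Fin d₁ → ℤ) (ξ : EuclideanSpace ℝ (Fin d₂)) :
    dualPoint A n ξ ∈ dualSet (matSubgroup A) := by
  intro t ht
  obtain ⟨m, rfl⟩ := (mem_matSubgroup_iff hA).1 ht
  refine ⟨∑ i, n i * m i, ?_⟩
  rw [real_inner_comm, inner_latticeEquiv_dualPoint]
  simp

theorem isClosed_dualSet {n : ℕ} (T : AddSubgroup (EuclideanSpace ℝ (Fin n))) :
    IsClosed (dualSet T) := by
  have : dualSet T = ⋂ t ∈ T, (fun x : EuclideanSpace ℝ (Fin n) => ⟪x, t⟫) ⁻¹'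
      range (Int.cast : ℤ → ℝ) := by
    ext x
    simp [dualSet, eq_comm]
  rw [this]
  exact isClosed_biInter fun t _ =>
    Int.isClosedEmbedding_coe_real.isClosed_range.preimage (by fun_prop)

/-- The measure `Aᵀ(δ_{ℤ^{d₁}} × 𝔪_{d₂})` as a sum of images of Lebesgue measure. -/
theorem matMeasure_eq_sum : matMeasure Aᵀ (countIntProdLebesgue d₁ d₂) =
    ENNReal.ofReal |(Aᵀ)⁻¹.det| •
      Measure.sum fun n : Fin d₁ → ℤ => Measure.map (dualPoint A n) volume := by
  rw [matMeasure, countIntProdLebesgue, countInt, Measure.prod_sum_left,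
    Measure.map_sum continuous_joinCoords.measurable.aemeasurable,
    Measure.map_sum (continuous_toEuclideanLin _).measurable.aemeasurable]
  congr 2
  ext1 n
  rw [Measure.dirac_prod, Measure.map_map continuous_joinCoords.measurable (by fun_prop),
    Measure.map_map (continuous_toEuclideanLin _).measurable
      (continuous_joinCoords.measurable.comp (by fun_prop))]
  rfl

theorem matMeasure_compl_dualSet (hA : IsUnit A.det) :
    matMeasure Aᵀ (countIntProdLebesgue d₁ d₂) (dualSet (matSubgroup A))ᶜ = 0 := by
  rw [matMeasure_eq_sum]
  change ∀ᵐ w ∂_, w ∈ dualSet (matSubgroup A)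
  refine Measure.ae_smul_measure ?_ _
  rw [Measure.ae_sum_iff]
  intro n
  exact (ae_map_iff (p := (· ∈ dualSet (matSubgroup A)))
    (continuous_dualPoint n).measurable.aemeasurable (isClosed_dualSet _).measurableSet).2
      (.of_forall fun ξ => dualPoint_mem_dualSet hA n ξ)

/-- The integer points form a closed discrete set, so a compact set contains finitely many of them.
-/
theorem isFiniteMeasureOnCompacts_countInt (n : ℕ) : IsFiniteMeasureOnCompacts (countInt n) := by
  refine ⟨fun K hK => ?_⟩
  have hemb : IsClosedEmbedding (fun m : Fin n → ℤ => fun i => (m i : ℝ)) :=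
    IsClosedEmbedding.piMap fun _ : Fin n => Int.isClosedEmbedding_coe_real
  have hemb' : IsClosedEmbedding
      (fun m : Fin n → ℤ => (WithLp.toLp 2 fun i => (m i : ℝ) : EuclideanSpace ℝ (Fin n))) :=
    (EuclideanSpace.equiv (Fin n) ℝ).symm.toHomeomorph.isClosedEmbedding.comp hemb
  have hfin := (hemb'.isCompact_preimage hK).finite_of_discrete
  rw [countInt, Measure.sum_apply _ hK.measurableSet]
  have : ∀ m : Fin n → ℤ,
      Measure.dirac (WithLp.toLp 2 fun i => (m i : ℝ) : EuclideanSpace ℝ (Fin n)) K =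
        ((fun m : Fin n → ℤ => (WithLp.toLp 2 fun i => (m i : ℝ) : EuclideanSpace ℝ (Fin n))) ⁻¹'
          K).indicator 1 m := by
    intro m
    rw [Measure.dirac_apply' _ hK.measurableSet]
    rfl
  simp only [this]
  rw [tsum_eq_sum (s := hfin.toFinset) fun m hm => indicator_of_notMem (by simpa using hm) _]
  classical
  refine ENNReal.sum_lt_top.2 fun m _ => ?_
  rw [indicator_apply]
  split_ifs <;> simp

theorem regular_matMeasure (hA : IsUnit A.det) : (matMeasure Aᵀ (countIntProdLebesgue d₁ d₂)).Regular := by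
  have := isFiniteMeasureOnCompacts_countInt d₁
  have : SFinite (countInt d₁) := by
    unfold countInt
    infer_instance
  have hAt : IsUnit (Aᵀ)⁻¹.det := by
    rw [Matrix.isUnit_nonsing_inv_det_iff, Matrix.det_transpose]
    exact hA
  set e : (EuclideanSpace ℝ (Fin d₁) × EuclideanSpace ℝ (Fin d₂)) ≃L[ℝ]
      EuclideanSpace ℝ (Fin (d₁ + d₂)) :=
    ((EuclideanSpace.equiv (Fin d₁) ℝ).prodCongr (.refl ℝ _)).trans
      ((joinEquiv d₁ d₂).trans (matEquiv _ hAt)) with he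
  have : IsFiniteMeasureOnCompacts (matMeasure Aᵀ (countIntProdLebesgue d₁ d₂)) := by
    refine ⟨fun K hK => ?_⟩
    have hmap : matMeasure Aᵀ (countIntProdLebesgue d₁ d₂) = ENNReal.ofReal |(Aᵀ)⁻¹.det| •
        Measure.map e ((countInt d₁).prod volume) := by
      rw [matMeasure, countIntProdLebesgue, Measure.map_map
        (continuous_toEuclideanLin _).measurable continuous_joinCoords.measurable]
      rfl
    rw [hmap, Measure.smul_apply, Measure.map_apply e.continuous.measurable hK.measurableSet,
      smul_eq_mul]
    have hc : IsCompact (e ⁻¹' K) := e.toHomeomorph.isCompact_preimage.2 hK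
    exact ENNReal.mul_lt_top ENNReal.ofReal_lt_top hc.measure_lt_top
  infer_instance

end Coordinates

/-! ### The model cell and its pair measure -/

section Parallelepiped

variable {d₁ d₂ : ℕ} {A : Matrix (Fin (d₁ + d₂)) (Fin (d₁ + d₂)) ℝ}
  {f : EuclideanSpace ℝ (Fin (d₁ + d₂)) → ℂ}

/-- The image under `A` of the product of the unit cube with `ℝ^{d₂}`. -/
def latticeCell (hA : IsUnit A.det) : Set (EuclideanSpace ℝ (Fin (d₁ + d₂))) :=
  {x | ((latticeEquiv A hA).symm x).1 ∈ unitCube d₁}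

theorem measurableSet_latticeCell (hA : IsUnit A.det) : MeasurableSet (latticeCell hA) :=
  (measurable_fst.comp (latticeEquiv A hA).symm.continuous.measurable) measurableSet_unitCube

theorem isAddFundamentalDomain_latticeCell (hA : IsUnit A.det) :
    IsAddFundamentalDomain (matSubgroup A) (latticeCell hA) volume := by
  refine .mk' (measurableSet_latticeCell hA).nullMeasurableSet fun x => ?_
  have hsymm : ∀ n : Fin d₁ → ℤ,
      ((latticeEquiv A hA).symm (latticeEquiv A hA (fun i => (n i : ℝ), 0) + x)).1 =
        fun i => ((latticeEquiv A hA).symm x).1 i + n i := by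
    intro n
    rw [map_add, ContinuousLinearEquiv.symm_apply_apply]
    ext i
    simp [add_comm]
  choose n hn hn' using fun i : Fin d₁ => existsUnique_add_zsmul_mem_Ioc (zero_lt_one (α := ℝ))
    (((latticeEquiv A hA).symm x).1 i) 0
  simp only [zero_add, zsmul_eq_mul, mul_one] at hn hn'
  refine ⟨⟨_, (mem_matSubgroup_iff hA).2 ⟨n, rfl⟩⟩, ?_, ?_⟩
  · change ((latticeEquiv A hA).symm (latticeEquiv A hA (fun i => (n i : ℝ), 0) + x)).1 ∈ unitCube d₁
    rw [hsymm]
    exact hn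
  · rintro ⟨t, ht⟩ htx
    obtain ⟨m, rfl⟩ := (mem_matSubgroup_iff hA).1 ht
    change ((latticeEquiv A hA).symm (latticeEquiv A hA (fun i => (m i : ℝ), 0) + x)).1 ∈ unitCube d₁ at htx
    rw [hsymm] at htx
    have : m = n := funext fun i => hn' i (m i) (htx i)
    subst this
    rfl

theorem ofReal_abs_det_mul (hA : IsUnit A.det) :
    ENNReal.ofReal |(Aᵀ)⁻¹.det| * ENNReal.ofReal |A.det| = 1 := by
  rw [← ENNReal.ofReal_mul (abs_nonneg _), ← abs_mul, Matrix.det_nonsing_inv, Matrix.det_transpose,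
    Ring.inverse_mul_cancel _ hA]
  simp

theorem volume_restrict_latticeCell (hA : IsUnit A.det) :
    volume.restrict (latticeCell hA) = ENNReal.ofReal |A.det| •
      Measure.map (latticeEquiv A hA) (cubeProdMeasure d₁ (EuclideanSpace ℝ (Fin d₂))) := by
  have hmat : Measure.map (Matrix.toEuclideanLin A)
      (volume : Measure (EuclideanSpace ℝ (Fin (d₁ + d₂)))) =
        ENNReal.ofReal |(Aᵀ)⁻¹.det| • volume := by
    rw [Measure.map_linearMap_addHaar_eq_smul_addHaar _ (by
      rw [det_toEuclideanLin]; exact hA.ne_zero), det_toEuclideanLin, Matrix.det_nonsing_inv,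
      Matrix.det_transpose, Ring.inverse_eq_inv']
  have hL : Measure.map (latticeEquiv A hA) (volume.prod volume) =
      ENNReal.ofReal |(Aᵀ)⁻¹.det| • volume := by
    rw [← hmat, ← map_joinEquiv_volume,
      Measure.map_map (continuous_toEuclideanLin A).measurable
        (joinEquiv d₁ d₂).continuous.measurable]
    rfl
  have hcube : cubeProdMeasure d₁ (EuclideanSpace ℝ (Fin d₂)) =
      (volume.prod volume).restrict (latticeEquiv A hA ⁻¹' latticeCell hA) := by
    rw [cubeProdMeasure, ← Measure.restrict_univ (μ := (volume : Measure (EuclideanSpace ℝ (Fin d₂)))),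
      Measure.prod_restrict]
    simp only [Measure.restrict_univ]
    congr 1
    ext p
    simp [latticeCell]
  rw [hcube, ← Measure.restrict_map (latticeEquiv A hA).continuous.measurable
    (measurableSet_latticeCell hA), hL, Measure.restrict_smul, smul_smul, mul_comm,
    ofReal_abs_det_mul hA, one_smul]

theorem measurableEmbedding_latticeEquiv (hA : IsUnit A.det) :
    MeasurableEmbedding (latticeEquiv A hA) :=
  (latticeEquiv A hA).toHomeomorph.measurableEmbedding

theorem ofReal_abs_det_ne_zero (hA : IsUnit A.det) : ENNReal.ofReal |A.det| ≠ 0 := by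
  simpa using hA.ne_zero

theorem memLp_latticeCell_iff (hA : IsUnit A.det) (p : ℝ≥0∞) :
    MemLp f p (volume.restrict (latticeCell hA)) ↔
      MemLp (f ∘ latticeEquiv A hA) p (cubeProdMeasure d₁ (EuclideanSpace ℝ (Fin d₂))) := by
  rw [volume_restrict_latticeCell, ← (measurableEmbedding_latticeEquiv hA).memLp_map_measure_iff]
  refine ⟨fun h => h.of_measure_le_smul (c := (ENNReal.ofReal |A.det|)⁻¹)
    (ENNReal.inv_ne_top.2 (ofReal_abs_det_ne_zero hA)) ?_,
    fun h => h.smul_measure ENNReal.ofReal_ne_top⟩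
  rw [smul_smul, ENNReal.inv_mul_cancel (ofReal_abs_det_ne_zero hA) ENNReal.ofReal_ne_top, one_smul]

theorem fourierOn_latticeCell (hA : IsUnit A.det) (n : Fin d₁ → ℤ)
    (ξ : EuclideanSpace ℝ (Fin d₂)) :
    fourierOn (latticeCell hA) f (dualPoint A n ξ) =
      ((|A.det| : ℝ) : ℂ) * mixedFourier (f ∘ latticeEquiv A hA) n ξ := by
  rw [fourierOn_eq_setIntegral (measurableSet_latticeCell hA).nullMeasurableSet,
    volume_restrict_latticeCell, integral_smul_measure,
    (measurableEmbedding_latticeEquiv hA).integral_map, ENNReal.toReal_ofReal (abs_nonneg _),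
    mixedFourier]
  simp only [inner_latticeEquiv_dualPoint, Function.comp_apply, Complex.real_smul]

theorem lintegral_matMeasure {F : EuclideanSpace ℝ (Fin (d₁ + d₂)) → ℝ≥0∞} (hF : Measurable F) :
    ∫⁻ w, F w ∂matMeasure Aᵀ (countIntProdLebesgue d₁ d₂) =
      ENNReal.ofReal |(Aᵀ)⁻¹.det| * ∑' n : Fin d₁ → ℤ, ∫⁻ ξ, F (dualPoint A n ξ) := by
  rw [matMeasure_eq_sum, lintegral_smul_measure, lintegral_sum_measure, smul_eq_mul]
  congr 2
  ext n
  rw [lintegral_map hF (continuous_dualPoint n).measurable]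

theorem integral_matMeasure (hA : IsUnit A.det) {F : EuclideanSpace ℝ (Fin (d₁ + d₂)) → ℂ}
    (hF : StronglyMeasurable F)
    (hint : Integrable F (matMeasure Aᵀ (countIntProdLebesgue d₁ d₂))) :
    ∫ w, F w ∂matMeasure Aᵀ (countIntProdLebesgue d₁ d₂) =
      |(Aᵀ)⁻¹.det| • ∑' n : Fin d₁ → ℤ, ∫ ξ, F (dualPoint A n ξ) := by
  rw [matMeasure_eq_sum] at hint ⊢
  rw [integrable_smul_measure (left_ne_zero_of_mul_eq_one (ofReal_abs_det_mul hA))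
    ENNReal.ofReal_ne_top] at hint
  rw [integral_smul_measure, integral_sum_measure hint, ENNReal.toReal_ofReal (abs_nonneg _)]
  congr 2
  ext n
  rw [integral_map_of_stronglyMeasurable (continuous_dualPoint n).measurable hF]

theorem continuous_fourierOn {d : ℕ} {Ω : Set (EuclideanSpace ℝ (Fin d))}
    {f : EuclideanSpace ℝ (Fin d) → ℂ} (hΩ : NullMeasurableSet Ω volume) (hf : InL1L2 Ω f) :
    Continuous (fourierOn Ω f) :=
  continuous_fourier_of_integrable (hf.integrable_indicator hΩ)

/-- The transform carries a factor `|det A|`, squared here; the weight `|det A|⁻¹` of the measure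
cancels one power, and the other is the Jacobian of the cell. -/
theorem eLpNorm_fourierOn_latticeCell (hA : IsUnit A.det) (hf : InL1L2 (latticeCell hA) f) :
    eLpNorm (fourierOn (latticeCell hA) f) 2 (matMeasure Aᵀ (countIntProdLebesgue d₁ d₂)) =
      eLpNorm f 2 (volume.restrict (latticeCell hA)) := by
  have hcont := continuous_fourierOn (measurableSet_latticeCell hA).nullMeasurableSet hf
  rw [eLpNorm_two_eq_lintegral_sq, eLpNorm_two_eq_lintegral_sq,
    lintegral_matMeasure (hcont.measurable.enorm.pow_const 2), volume_restrict_latticeCell,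
    lintegral_smul_measure, (measurableEmbedding_latticeEquiv hA).lintegral_map, smul_eq_mul]
  have h2 := (memLp_latticeCell_iff hA 2).1 hf.2
  have h1 := memLp_one_iff_integrable.1 ((memLp_latticeCell_iff hA 1).1 hf.1)
  have hn : ‖((|A.det| : ℝ) : ℂ)‖ₑ = ENNReal.ofReal |A.det| := by
    rw [← ofReal_norm, Complex.norm_real, Real.norm_eq_abs, abs_abs]
  simp only [fourierOn_latticeCell, enorm_mul, mul_pow, hn]
  congr 1
  rw [tsum_congr fun n => lintegral_const_mul' _ _ (by simp), ENNReal.tsum_mul_left,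
    tsum_lintegral_sq_mixedFourier h1 h2, sq, ← mul_assoc, ← mul_assoc, ofReal_abs_det_mul hA,
    one_mul]
  rfl

theorem InL1L2.add {d : ℕ} {Ω : Set (EuclideanSpace ℝ (Fin d))}
    {f g : EuclideanSpace ℝ (Fin d) → ℂ} (hf : InL1L2 Ω f) (hg : InL1L2 Ω g) : InL1L2 Ω (f + g) :=
  ⟨hf.1.add hg.1, hf.2.add hg.2⟩

/-- The range of the Fourier transform on `L¹(Ω) ∩ L²(Ω)` as a subspace of `L²(μ)`. -/
def fourierRange {d : ℕ} {Ω : Set (EuclideanSpace ℝ (Fin d))} (hΩ : NullMeasurableSet Ω volume)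
    (μ : Measure (EuclideanSpace ℝ (Fin d))) : Submodule ℂ (Lp ℂ 2 μ) where
  carrier := {g : Lp ℂ 2 μ | ∃ f, InL1L2 Ω f ∧ g =ᵐ[μ] fourierOn Ω f}
  zero_mem' := by
    refine ⟨0, ⟨MemLp.zero, MemLp.zero⟩, (Lp.coeFn_zero _ _ _).trans (.of_forall fun w => ?_)⟩
    simp [fourierOn, Real.fourier_eq]
  add_mem' := by
    rintro g g' ⟨f, hf, hg⟩ ⟨f', hf', hg'⟩
    refine ⟨f + f', hf.add hf', (Lp.coeFn_add _ _).trans ?_⟩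
    filter_upwards [hg, hg'] with w hw hw'
    rw [Pi.add_apply, hw, hw', fourierOn, fourierOn, fourierOn, indicator_add']
    simp only [Real.fourier_eq, Pi.add_apply, smul_add]
    exact (integral_add
      ((Real.fourierIntegral_convergent_iff w).2 (hf.integrable_indicator hΩ))
      ((Real.fourierIntegral_convergent_iff w).2 (hf'.integrable_indicator hΩ))).symm
  smul_mem' := by
    rintro c g ⟨f, hf, hg⟩
    refine ⟨c • f, ⟨hf.1.const_smul c, hf.2.const_smul c⟩, (Lp.coeFn_smul _ _).trans ?_⟩
    filter_upwards [hg] with w hw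
    rw [Pi.smul_apply, hw, fourierOn_eq_setIntegral hΩ, fourierOn_eq_setIntegral hΩ,
      ← integral_smul]
    congr 1
    ext v
    rw [Pi.smul_apply, smul_comm]

theorem map_dualPoint_le (hA : IsUnit A.det) (n : Fin d₁ → ℤ) :
    Measure.map (dualPoint A n) volume ≤
      ENNReal.ofReal |A.det| • matMeasure Aᵀ (countIntProdLebesgue d₁ d₂) := by
  rw [matMeasure_eq_sum, smul_smul, mul_comm, ofReal_abs_det_mul hA, one_smul]
  exact Measure.le_sum _ n

theorem ae_eq_zero_of_mem_orthogonal_fourierRange (hA : IsUnit A.det)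
    {H : Lp ℂ 2 (matMeasure Aᵀ (countIntProdLebesgue d₁ d₂))}
    (hH : H ∈ (fourierRange (measurableSet_latticeCell hA).nullMeasurableSet
      (matMeasure Aᵀ (countIntProdLebesgue d₁ d₂)))ᗮ) (n : Fin d₁ → ℤ) :
    ∀ᵐ ξ, H (dualPoint A n ξ) = 0 := by
  -- Each sheet is dominated by a multiple of the whole measure, so `H` restricts to an `L²`
  -- function on it.
  have hHn : MemLp (fun ξ => H (dualPoint A n ξ)) 2 volume :=
    ((Lp.memLp H).of_measure_le_smul ENNReal.ofReal_ne_top (map_dualPoint_le hA n)).comp_of_map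
      (continuous_dualPoint n).measurable.aemeasurable
  refine ae_eq_zero_of_integral_contDiff_smul_eq_zero (hHn.locallyIntegrable (by norm_num))
    fun g hg hgc => ?_
  have hgc' : HasCompactSupport (fun x => (g x : ℂ)) := hgc.comp_left Complex.ofReal_zero
  have hg' : ContDiff ℝ ((⊤ : ℕ∞) : WithTop ℕ∞) (fun x => (g x : ℂ)) :=
    Complex.ofRealCLM.contDiff.comp hg
  set ψ : 𝓢(EuclideanSpace ℝ (Fin d₂), ℂ) := hgc'.toSchwartzMap hg' with hψ
  -- Chosen so that the transform is `|det A| * g` on the sheet `n` and zero on the others;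
  -- orthogonality to it says that `H` on that sheet integrates to zero against `g`.
  set f : EuclideanSpace ℝ (Fin (d₁ + d₂)) → ℂ :=
    charMul n (𝓕⁻ ψ) ∘ (latticeEquiv A hA).symm with hf
  have hfL : f ∘ latticeEquiv A hA = charMul n (𝓕⁻ ψ) := by
    ext p
    simp [hf]
  have hf1 : InL1L2 (latticeCell hA) f := by
    refine ⟨(memLp_latticeCell_iff hA 1).2 ?_, (memLp_latticeCell_iff hA 2).2 ?_⟩ <;>
    · rw [hfL]
      exact memLp_charMul _ _ _
  have hval : ∀ m ξ, fourierOn (latticeCell hA) f (dualPoint A m ξ) =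
      if m = n then ((|A.det| : ℝ) : ℂ) * (g ξ : ℂ) else 0 := by
    intro m ξ
    rw [fourierOn_latticeCell, hfL, mixedFourier_charMul, FourierTransform.fourier_fourierInv_eq]
    split_ifs
    · rfl
    · rw [mul_zero]
  have hcont := continuous_fourierOn (measurableSet_latticeCell hA).nullMeasurableSet hf1
  have hFL : MemLp (fourierOn (latticeCell hA) f) 2
      (matMeasure Aᵀ (countIntProdLebesgue d₁ d₂)) :=
    ⟨hcont.aestronglyMeasurable, by
      rw [eLpNorm_fourierOn_latticeCell hA hf1]
      exact hf1.2.2⟩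
  have h0 := (Submodule.mem_orthogonal _ _).1 hH hFL.toLp ⟨f, hf1, hFL.coeFn_toLp⟩
  have hint := L2.integrable_inner (𝕜 := ℂ) hFL.toLp H
  rw [L2.inner_def] at h0
  have hae : (fun w => inner ℂ ((hFL.toLp : Lp ℂ 2 _) w) (H w)) =ᵐ[matMeasure Aᵀ (countIntProdLebesgue d₁ d₂)]
      fun w => inner ℂ (fourierOn (latticeCell hA) f w) (H w) := by
    filter_upwards [hFL.coeFn_toLp] with w hw
    rw [hw]
  rw [integral_congr_ae hae] at h0
  replace hint := hint.congr hae
  have hmeas : StronglyMeasurable fun w => inner ℂ (fourierOn (latticeCell hA) f w) (H w) :=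
    hcont.stronglyMeasurable.inner (Lp.stronglyMeasurable H)
  have hc0 : |(Aᵀ)⁻¹.det| ≠ 0 := by
    have := left_ne_zero_of_mul_eq_one (ofReal_abs_det_mul hA)
    contrapose! this
    rw [this, ENNReal.ofReal_zero]
  rw [integral_matMeasure hA hmeas hint, tsum_eq_single n, smul_eq_zero_iff_right hc0] at h0
  · simp only [hval, if_true] at h0
    have : ∀ ξ, inner ℂ (((|A.det| : ℝ) : ℂ) * (g ξ : ℂ)) (H (dualPoint A n ξ)) =
        ((|A.det| : ℝ) : ℂ) * (g ξ • H (dualPoint A n ξ)) := by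
      intro ξ
      rw [RCLike.inner_apply, map_mul, Complex.conj_ofReal, Complex.conj_ofReal, Complex.real_smul]
      ring
    simp only [this] at h0
    rw [integral_const_mul, mul_eq_zero_iff_left (by simpa using hA.ne_zero)] at h0
    exact h0
  · intro m hm
    simp [hval, hm]

/-- The measure `Aᵀ(δ_{ℤ^{d₁}} × 𝔪_{d₂})` is a pair measure for `A([0,1]^{d₁} × ℝ^{d₂})`. -/
theorem isPairMeasure_latticeCell (hA : IsUnit A.det) :
    IsPairMeasure (latticeCell hA) (matMeasure Aᵀ (countIntProdLebesgue d₁ d₂)) := by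
  refine ⟨regular_matMeasure hA, fun f hf => ?_,
    fun f hf => eLpNorm_fourierOn_latticeCell hA hf, ?_⟩
  · refine ⟨(continuous_fourierOn (measurableSet_latticeCell hA).nullMeasurableSet
      hf).aestronglyMeasurable, ?_⟩
    rw [eLpNorm_fourierOn_latticeCell hA hf]
    exact hf.2.2
  · change Dense (SetLike.coe (fourierRange (measurableSet_latticeCell hA).nullMeasurableSet
      (matMeasure Aᵀ (countIntProdLebesgue d₁ d₂))))
    rw [Submodule.dense_iff_topologicalClosure_eq_top, Submodule.topologicalClosure_eq_top_iff,
      Submodule.eq_bot_iff]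
    intro H hH
    refine (Lp.eq_zero_iff_ae_eq_zero).2 ?_
    rw [EventuallyEq]
    have hm : MeasurableSet {w | H w = (0 : ℂ)} :=
      (Lp.stronglyMeasurable H).measurable (measurableSet_singleton 0)
    have hall : ∀ᵐ w ∂Measure.sum fun n : Fin d₁ → ℤ =>
        Measure.map (dualPoint (d₂ := d₂) A n) volume, H w = 0 := by
      rw [Measure.ae_sum_iff]
      intro n
      exact (ae_map_iff (continuous_dualPoint n).measurable.aemeasurable hm).2
        (ae_eq_zero_of_mem_orthogonal_fourierRange hA hH n)
    have hsmul := Measure.ae_smul_measure hall (ENNReal.ofReal |(Aᵀ)⁻¹.det|)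
    -- The type of `H` depends on the measure; a plain function allows the measure to be rewritten.
    generalize (H : EuclideanSpace ℝ (Fin (d₁ + d₂)) → ℂ) = h at hsmul ⊢
    rwa [matMeasure_eq_sum]

end Parallelepiped

theorem theorem5p9 (d₁ d₂ : ℕ) (A : Matrix (Fin (d₁ + d₂)) (Fin (d₁ + d₂)) ℝ) (hA : IsUnit A.det)
    (Ω : Set (EuclideanSpace ℝ (Fin (d₁ + d₂)))) (hΩ : NullMeasurableSet Ω volume) :
    (Tiles Ω (matSubgroup A : Set (EuclideanSpace ℝ (Fin (d₁ + d₂)))) ↔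
      IsPairMeasure Ω (matMeasure Aᵀ (countIntProdLebesgue d₁ d₂))) ∧
    matMeasure Aᵀ (countIntProdLebesgue d₁ d₂) (dualSet (matSubgroup A))ᶜ = 0 := by
  have hμ := matMeasure_compl_dualSet hA
  have := countable_matSubgroup hA
  have hD := isAddFundamentalDomain_latticeCell hA
  have hDμ := isPairMeasure_latticeCell hA
  rw [tiles_iff_isAddFundamentalDomain hΩ]
  exact ⟨⟨fun h => hDμ.of_isAddFundamentalDomain hD h hμ,
    fun h => h.isAddFundamentalDomain hΩ hμ hD hDμ⟩, hμ⟩
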